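/- Let $V$ be a finite-dimensional real inner product space, with Lebesgue measure $\mathrm{Vol}$. A (central) hyperplane arrangement $\mathcal H$ in $V$ is a finite set of linear subspaces of $V$ of codimension $1$. Its chambers are the connected components of $V\setminus\bigcup_{H\in\mathcal H}H$. Fix a base chamber $T_0$. For a chamber $T$ put $(-1)^T=(-1)^{m}$, where $m$ is the number of hyperplanes $H\in\mathcal H$ such that $T_0$ and $T$ lie on different sides of $H$. For a measurable set $K\subseteq V$ of finite volume, the pizza quantity of $K$ is $$P(\mathcal H,K)=\sum_{T}(-1)^T\,\mathrm{Vol}(K\cap T),$$ where $T$ ranges over the chambers of $\mathcal H$. The arrangement $\mathcal H$ is a Coxeter arrangement if the group generated by the orthogonal reflections in the hyperplanes of $\mathcal H$ is finite and $\mathcal H$ is closed under all these reflections. Write $\mathbb B(a,R)=\{x\in V:\|x-a\|\le R\}$. Let $\mathcal H$ be a Coxeter arrangement in $V$ with $|\mathcal H|\ge\dim V$, and let $T_0$ be any base chamber. (i) If $|\mathcal H|>\dim V$ and $|\mathcal H|\equiv\dim V \pmod 2$, then $P(\mathcal H,\mathbb B(a,R))=0$ for all $a\in V$ and all $R\ge\|a\|$.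 (ii) If $|\mathcal H|>\dim V$ and $|\mathcal H|\not\equiv\dim V\pmod 2$, then for every fixed $a\in V$, $P(\mathcal H,\mathbb B(a,R))\to 0$ as $R\to\infty$. (iii) If $|\mathcal H|=\dim V$, then for every $a\in V$ the quantity $P(\mathcal H,\mathbb B(a,R))$ does not depend on $R$ as long as $R\ge\|a\|$. -/

import Mathlib

open MeasureTheory Filter Topology Module
open scoped InnerProductSpace Finset

noncomputable section

namespace Pizza

variable {V : Type*} [NormedAddCommGroup V] [InnerProductSpace ℝ V]

/-- A finite set `ℋ` of linear subspaces is a (central) hyperplane arrangement if all its members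
are linear hyperplanes, that is, have codimension one. -/
def IsArrangement (ℋ : Finset (Submodule ℝ V)) : Prop :=
  ∀ H ∈ ℋ, finrank ℝ H + 1 = finrank ℝ V

/-- The complement in `V` of the union of the hyperplanes. -/
def complement (ℋ : Finset (Submodule ℝ V)) : Set V :=
  {x | ∀ H ∈ ℋ, x ∉ H}

/-- The chambers: the connected components of the complement of the arrangement. -/
def chambers (ℋ : Finset (Submodule ℝ V)) : Set (Set V) :=
  {T | ∃ x ∈ complement ℋ, T = connectedComponentIn (complement ℋ) x}

/-- `T₁` and `T₂` lie on different sides of the hyperplane `H`: some normal vector of `H` is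
negative on `T₁` and positive on `T₂`. -/
def OppositeSides (H : Submodule ℝ V) (T₁ T₂ : Set V) : Prop :=
  ∃ e ∈ Hᗮ, (∀ x ∈ T₁, ⟪e, x⟫_ℝ < 0) ∧ (∀ y ∈ T₂, 0 < ⟪e, y⟫_ℝ)

open Classical in
/-- The separation set of two chambers: the hyperplanes of `ℋ` that separate them. -/
def separationSet (ℋ : Finset (Submodule ℝ V)) (T₁ T₂ : Set V) : Finset (Submodule ℝ V) :=
  {H ∈ ℋ | OppositeSides H T₁ T₂}

/-- The sign `(-1)^T` of a chamber `T`, with respect to the base chamber `T₀`. -/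
def chamberSign (ℋ : Finset (Submodule ℝ V)) (T₀ T : Set V) : ℝ :=
  (-1) ^ #(separationSet ℋ T₀ T)

variable [FiniteDimensional ℝ V]

/-- There are only finitely many chambers, so sums over the chambers are genuine finite sums. -/
theorem chambers_finite {ℋ : Finset (Submodule ℝ V)} (hℋ : IsArrangement ℋ) :
    (chambers ℋ).Finite := by
  classical
  have key : ∀ H ∈ ℋ, ∃ n : V, ∀ x, x ∈ H ↔ ⟪n, x⟫_ℝ = 0 := by
    intro H hH
    have h1 := H.finrank_add_finrank_orthogonal
    have h2 := hℋ H hH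
    obtain ⟨⟨n, hn⟩, hn0, hspan⟩ := finrank_eq_one_iff'.1 (show finrank ℝ Hᗮ = 1 by omega)
    refine ⟨n, fun x => ⟨fun hx => ?_, fun hx => ?_⟩⟩
    · exact H.inner_left_of_mem_orthogonal hx hn
    · rw [← H.orthogonal_orthogonal, Submodule.mem_orthogonal]
      intro u hu
      obtain ⟨c, hc⟩ := hspan ⟨u, hu⟩
      have : u = c • n := by simpa using (congrArg Subtype.val hc).symm
      rw [this, inner_smul_left, hx, mul_zero]
  choose! n hn using key
  let f : V → (ℋ → SignType) := fun x H => SignType.sign ⟪n H, x⟫_ℝ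
  have hf : ∀ x ∈ complement ℋ, ∀ y, f x = f y →
      connectedComponentIn (complement ℋ) x = connectedComponentIn (complement ℋ) y := by
    intro x hx y hxy
    have hseg : segment ℝ x y ⊆ complement ℋ := by
      rintro z ⟨s, t, hs, ht, hst, rfl⟩ H hH hz
      have h0 : ⟪n H, x⟫_ℝ ≠ 0 := fun h => hx H hH ((hn H hH x).2 h)
      have h1 : SignType.sign ⟪n H, x⟫_ℝ = SignType.sign ⟪n H, y⟫_ℝ := congrFun hxy ⟨H, hH⟩
      rw [hn H hH, inner_add_right, inner_smul_right, inner_smul_right] at hz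
      rcases lt_or_gt_of_ne h0 with h | h
      · have h2 : ⟪n H, y⟫_ℝ < 0 := by
          rw [sign_neg h] at h1; exact sign_eq_neg_one_iff.1 h1.symm
        rcases hs.eq_or_lt with rfl | hs
        · nlinarith
        · nlinarith [mul_neg_of_pos_of_neg hs h, mul_nonpos_of_nonneg_of_nonpos ht h2.le]
      · have h2 : 0 < ⟪n H, y⟫_ℝ := by
          rw [sign_pos h] at h1; exact sign_eq_one_iff.1 h1.symm
        rcases hs.eq_or_lt with rfl | hs
        · nlinarith
        · nlinarith [mul_pos hs h, mul_nonneg ht h2.le]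
    exact connectedComponentIn_eq ((convex_segment x y).isPreconnected.subset_connectedComponentIn
      (left_mem_segment ℝ x y) hseg (right_mem_segment ℝ x y))
  let g : (ℋ → SignType) → Set V := fun s =>
    if h : ∃ x ∈ complement ℋ, f x = s then connectedComponentIn (complement ℋ) h.choose else ∅
  refine (Set.finite_range g).subset ?_
  rintro T ⟨x, hx, rfl⟩
  have h : ∃ y ∈ complement ℋ, f y = f x := ⟨x, hx, rfl⟩
  refine ⟨f x, ?_⟩
  simp only [g, dif_pos h]
  exact hf _ h.choose_spec.1 _ h.choose_spec.2

/-- The Coxeter group: the group of isometries generated by the orthogonal reflections in the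
hyperplanes of `ℋ`. -/
def coxeterGroup (ℋ : Finset (Submodule ℝ V)) : Subgroup (V ≃ₗᵢ[ℝ] V) :=
  Subgroup.closure {s | ∃ H ∈ ℋ, s = H.reflection}

/-- A Coxeter arrangement: a hyperplane arrangement whose reflections generate a finite group
and which is closed under all these reflections. -/
structure IsCoxeterArrangement (ℋ : Finset (Submodule ℝ V)) : Prop where
  isArrangement : IsArrangement ℋ
  finite_coxeterGroup : Finite (coxeterGroup ℋ)
  reflection_mem : ∀ H ∈ ℋ, ∀ H' ∈ ℋ, H'.map (H.reflection.toLinearEquiv : V →ₗ[ℝ] V) ∈ ℋ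

/-- The pizza quantity `P(ℋ, K) = ∑_T (-1)^T Vol (K ∩ T)` of a set `K`, where `T` ranges over the
chambers of `ℋ`, the signs being taken with respect to the base chamber `T₀`. -/
def pizzaQuantity [MeasurableSpace V] [BorelSpace V] (ℋ : Finset (Submodule ℝ V)) (T₀ K : Set V) :
    ℝ :=
  ∑ᶠ T ∈ chambers ℋ, chamberSign ℋ T₀ T * (volume : Measure V).real (K ∩ T)

end Pizza

end

/-! Let `σ` be the product of the signs of the linear forms defining the hyperplanes, and put `m =
dim V`. It is constant on chambers and flips across each wall, so the pizza quantity is, up to a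
global sign, the integral of `σ` over the ball. Everything rests on two facts.

Antisymmetry: `σ (w x) = det w * σ x` for `w` in the Coxeter group (`signProd_coxeterGroup`).
Integrating `σ` against `⟪a, x⟫ ^ d` therefore only sees the antisymmetrization of that power. This
polynomial vanishes on every hyperplane, hence identically when `d < #ℋ`
(`sum_det_mul_inner_pow_eq_zero`). So all sphere moments of `σ` of degree below `#ℋ` are zero.

Polar coordinates: if `R ≥ ‖a‖`, the ball is star-shaped about the origin. With `t = ⟪a, u⟫` and `c
= R² - ‖a‖²`, the integral is the sphere integral of `σ u * (t + √(c + t²)) ^ m`, divided by `m`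
(`setIntegral_closedBall_signProd`).

For equal parities, averaging over `u ↦ -u` turns the power into half of `(t + √(c + t²)) ^ m + (t -
√(c + t²)) ^ m`, a polynomial in `t` of degree at most `m` whose degree-`m` coefficient does not
involve `c`. Only that coefficient can survive, which gives (i) and (iii). For (ii), with `ρ = √c`
the power is `ρ ^ m * f (t / ρ)` for a fixed smooth `f`. The Taylor polynomial of order `m`
integrates to zero and the remainder is `ρ ^ m * o(ρ ^ (-m))`. -/

noncomputable section

/-! ### Unit normals and antisymmetry of the sign product -/

namespace Pizza

variable {V : Type*} [NormedAddCommGroup V] [InnerProductSpace ℝ V]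

/-- `n` assigns to every member of `ℋ` a unit normal vector. -/
def IsUnitNormal (ℋ : Finset (Submodule ℝ V)) (n : Submodule ℝ V → V) : Prop :=
  ∀ H ∈ ℋ, ‖n H‖ = 1 ∧ ∀ x, x ∈ H ↔ ⟪n H, x⟫_ℝ = 0

/-- The product of the signs of the linear forms `⟪n H, ·⟫`. -/
def signProd (ℋ : Finset (Submodule ℝ V)) (n : Submodule ℝ V → V) (x : V) : ℝ :=
  ∏ H ∈ ℋ, ((SignType.sign ⟪n H, x⟫_ℝ : SignType) : ℝ)

theorem exists_isUnitNormal [FiniteDimensional ℝ V] {ℋ : Finset (Submodule ℝ V)}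
    (hℋ : IsArrangement ℋ) : ∃ n, IsUnitNormal ℋ n := by
  have key : ∀ H ∈ ℋ, ∃ n : V, ‖n‖ = 1 ∧ ∀ x, x ∈ H ↔ ⟪n, x⟫_ℝ = 0 := by
    intro H hH
    have h1 := H.finrank_add_finrank_orthogonal
    have h2 := hℋ H hH
    obtain ⟨⟨n, hn⟩, hn0, hspan⟩ := finrank_eq_one_iff'.1 (show finrank ℝ Hᗮ = 1 by omega)
    have hn0' : n ≠ 0 := fun h => hn0 (by simpa using h)
    refine ⟨‖n‖⁻¹ • n, ?_, fun x => ?_⟩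
    · simp [norm_smul, hn0']
    rw [real_inner_smul_left, mul_eq_zero, or_iff_right (by simpa using hn0')]
    refine ⟨fun hx => H.inner_left_of_mem_orthogonal hx hn, fun hx => ?_⟩
    rw [← H.orthogonal_orthogonal, Submodule.mem_orthogonal]
    intro u hu
    obtain ⟨c, hc⟩ := hspan ⟨u, hu⟩
    have : u = c • n := by simpa using (congrArg Subtype.val hc).symm
    rw [this, inner_smul_left, hx, mul_zero]
  choose! n hn using key
  exact ⟨n, hn⟩

/-- The vector `u - ⟪u, v⟫ • v` is orthogonal to `v`, hence to `u`, hence to itself. -/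
theorem eq_smul_of_inner_eq_zero_iff {u v : V} (hu : ‖u‖ = 1) (hv : ‖v‖ = 1)
    (h : ∀ x, ⟪v, x⟫_ℝ = 0 → ⟪u, x⟫_ℝ = 0) : u = ⟪u, v⟫_ℝ • v ∧ ⟪u, v⟫_ℝ ^ 2 = 1 := by
  have hvv : ⟪v, v⟫_ℝ = 1 := by rw [real_inner_self_eq_norm_sq, hv, one_pow]
  have huu : ⟪u, u⟫_ℝ = 1 := by rw [real_inner_self_eq_norm_sq, hu, one_pow]
  have h1 : ⟪v, u - ⟪u, v⟫_ℝ • v⟫_ℝ = 0 := by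
    rw [inner_sub_right, real_inner_smul_right, hvv, real_inner_comm]; ring
  have h2 := h _ h1
  refine ⟨?_, ?_⟩
  · rw [← sub_eq_zero, ← inner_self_eq_zero (𝕜 := ℝ), inner_sub_left, h2, real_inner_smul_left, h1]
    ring
  · rw [inner_sub_right, real_inner_smul_right, huu] at h2
    linarith

namespace IsUnitNormal

variable {ℋ : Finset (Submodule ℝ V)} {n : Submodule ℝ V → V}

theorem eq_of_inner_sq_eq_one (hn : IsUnitNormal ℋ n) {H H' : Submodule ℝ V} (hH : H ∈ ℋ)
    (hH' : H' ∈ ℋ) (h : ⟪n H, n H'⟫_ℝ ^ 2 = 1) : H = H' := by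
  have hvv : ⟪n H', n H'⟫_ℝ = 1 := by rw [real_inner_self_eq_norm_sq, (hn H' hH').1, one_pow]
  have huu : ⟪n H, n H⟫_ℝ = 1 := by rw [real_inner_self_eq_norm_sq, (hn H hH).1, one_pow]
  have h0 : ⟪n H, n H'⟫_ℝ ≠ 0 := fun h0 => by simp [h0] at h
  have h1 : n H = ⟪n H, n H'⟫_ℝ • n H' := by
    rw [← sub_eq_zero, ← inner_self_eq_zero (𝕜 := ℝ), inner_sub_left, inner_sub_right,
      inner_sub_right, real_inner_smul_left, real_inner_smul_left, real_inner_smul_right,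
      real_inner_smul_right, huu, hvv, real_inner_comm (n H) (n H')]
    linarith
  ext x
  rw [(hn H hH).2, (hn H' hH').2, h1, real_inner_smul_left, mul_eq_zero, or_iff_right h0]

variable [FiniteDimensional ℝ V]

theorem reflection_apply (hn : IsUnitNormal ℋ n) {H : Submodule ℝ V} (hH : H ∈ ℋ) (x : V) :
    H.reflection x = x - (2 * ⟪n H, x⟫_ℝ) • n H := by
  have hvv : ⟪n H, n H⟫_ℝ = 1 := by rw [real_inner_self_eq_norm_sq, (hn H hH).1, one_pow]
  have hp : H.starProjection x = x - ⟪n H, x⟫_ℝ • n H := by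
    refine Submodule.eq_starProjection_of_mem_of_inner_eq_zero ?_ ?_
    · rw [(hn H hH).2, inner_sub_right, real_inner_smul_right, hvv]; ring
    · intro w hw
      rw [sub_sub_cancel, real_inner_smul_left, ((hn H hH).2 w).1 hw, mul_zero]
  rw [Submodule.reflection_apply, hp]
  module

theorem reflection_self (hn : IsUnitNormal ℋ n) {H : Submodule ℝ V} (hH : H ∈ ℋ) :
    H.reflection (n H) = - n H := by
  rw [hn.reflection_apply hH, real_inner_self_eq_norm_sq, (hn H hH).1]
  module

/-- The reflection permutes `ℋ` by an involution `m` and sends `n H` to `ε H • n (m H)` with `ε H =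
±1`. In `∏ ε H` the two members of a swapped pair cancel, fixed hyperplanes other than `H₀` give
`1`, and `H₀` gives `-1`. -/
theorem signProd_reflection (hn : IsUnitNormal ℋ n) (hℋ : IsCoxeterArrangement ℋ)
    {H₀ : Submodule ℝ V} (hH₀ : H₀ ∈ ℋ) (x : V) :
    signProd ℋ n (H₀.reflection x) = - signProd ℋ n x := by
  classical
  set s := H₀.reflection with hs
  let m : Submodule ℝ V → Submodule ℝ V := fun H => H.map (s.toLinearEquiv : V →ₗ[ℝ] V)
  have hss : ∀ x, s (s x) = x := fun x => H₀.reflection_reflection x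
  have hsym : ∀ x y, ⟪s x, y⟫_ℝ = ⟪x, s y⟫_ℝ := fun x y => by
    rw [← s.inner_map_map x (s y), hss]
  have hmem : ∀ H x, x ∈ m H ↔ s x ∈ H := by
    intro H x
    constructor
    · rintro ⟨y, hy, rfl⟩
      simpa [hss] using hy
    · intro h
      exact ⟨s x, h, hss x⟩
  have hmm : ∀ H, m (m H) = H := fun H => by ext x; rw [hmem, hmem, hss]
  have hm : ∀ H ∈ ℋ, m H ∈ ℋ := fun H hH => hℋ.reflection_mem H₀ hH₀ H hH
  let ε : Submodule ℝ V → ℝ := fun H => ⟪s (n H), n (m H)⟫_ℝ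
  have hε : ∀ H ∈ ℋ, s (n H) = ε H • n (m H) ∧ ε H ^ 2 = 1 := by
    intro H hH
    refine eq_smul_of_inner_eq_zero_iff (by rw [s.norm_map, (hn H hH).1]) (hn _ (hm H hH)).1 ?_
    intro x hx
    rwa [← (hn _ (hm H hH)).2, hmem, (hn H hH).2, ← hsym] at hx
  have hεε : ∀ H, ε (m H) = ε H := by
    intro H
    simp only [ε, hmm]
    rw [hsym, real_inner_comm]
  have hm₀ : m H₀ = H₀ := by
    ext x
    rw [hmem, (hn H₀ hH₀).2, (hn H₀ hH₀).2, ← hsym, hs, hn.reflection_self hH₀, inner_neg_left,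
      neg_eq_zero]
  have hε₀ : ε H₀ = -1 := by
    simp only [ε, hm₀]
    rw [hs, hn.reflection_self hH₀, inner_neg_left, real_inner_self_eq_norm_sq, (hn H₀ hH₀).1,
      one_pow]
  have hprod : ∏ H ∈ ℋ, ε H = -1 := by
    rw [← Finset.mul_prod_erase ℋ ε hH₀, hε₀, Finset.prod_involution (fun H _ => m H), mul_one]
    · intro H hH
      rw [hεε, ← pow_two, (hε H (Finset.mem_of_mem_erase hH)).2]
    -- If `H` is fixed with `ε H = -1`, the reflection formula gives `1 - 2⟪n H₀, n H⟫² = -1`, which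
    -- forces `H = H₀`.
    · intro H hH hne heq
      have hH' := Finset.mem_of_mem_erase hH
      have h1 : ε H = -1 := (sq_eq_one_iff.1 (hε H hH').2).resolve_left hne
      simp only [ε, heq] at h1
      rw [hs, hn.reflection_apply hH₀, inner_sub_left, real_inner_smul_left,
        real_inner_self_eq_norm_sq, (hn H hH').1] at h1
      exact Finset.ne_of_mem_erase hH (hn.eq_of_inner_sq_eq_one hH₀ hH' (by linarith)).symm
    · intro H hH
      refine Finset.mem_erase.2 ⟨fun h => Finset.ne_of_mem_erase hH ?_,
        hm H (Finset.mem_of_mem_erase hH)⟩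
      rw [← hmm H, h, hm₀]
    · intro H _
      exact hmm H
  have hsign : ∀ H ∈ ℋ, ((SignType.sign ⟪n H, s x⟫_ℝ : SignType) : ℝ) =
      ε H * ((SignType.sign ⟪n (m H), x⟫_ℝ : SignType) : ℝ) := by
    intro H hH
    rw [← hsym, (hε H hH).1, real_inner_smul_left, sign_mul, SignType.coe_mul]
    rcases sq_eq_one_iff.1 (hε H hH).2 with h | h <;> rw [h] <;> simp
  rw [signProd, Finset.prod_congr rfl hsign, Finset.prod_mul_distrib, hprod, neg_one_mul, signProd]
  congr 1
  exact Finset.prod_bij' (fun H _ => m H) (fun H _ => m H) hm hm (fun H _ => hmm H)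
    (fun H _ => hmm H) (fun _ _ => rfl)

/-- Both sides are multiplicative in `w`, and each generating reflection has determinant `-1`. -/
theorem signProd_coxeterGroup (hn : IsUnitNormal ℋ n) (hℋ : IsCoxeterArrangement ℋ)
    {w : V ≃ₗᵢ[ℝ] V} (hw : w ∈ coxeterGroup ℋ) (x : V) :
    signProd ℋ n (w x) = LinearMap.det (w.toLinearEquiv : V →ₗ[ℝ] V) * signProd ℋ n x := by
  induction hw using Subgroup.closure_induction generalizing x with
  | mem s hs =>
    obtain ⟨H, hH, rfl⟩ := hs
    have h1 := H.finrank_add_finrank_orthogonal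
    have h2 := hℋ.isArrangement H hH
    have h3 : finrank ℝ Hᗮ = 1 := by omega
    rw [hn.signProd_reflection hℋ hH]
    have := H.det_reflection
    rw [h3, pow_one] at this
    erw [this]
    ring
  | one =>
    have : (((1 : V ≃ₗᵢ[ℝ] V).toLinearEquiv : V ≃ₗ[ℝ] V) : V →ₗ[ℝ] V) = LinearMap.id := rfl
    rw [this, LinearMap.det_id, one_mul]; rfl
  | mul v w _ _ hv hw =>
    have : (((v * w : V ≃ₗᵢ[ℝ] V).toLinearEquiv : V ≃ₗ[ℝ] V) : V →ₗ[ℝ] V) =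
      (v.toLinearEquiv : V →ₗ[ℝ] V) ∘ₗ (w.toLinearEquiv : V →ₗ[ℝ] V) := rfl
    rw [this, LinearMap.det_comp, mul_assoc, ← hw, ← hv]; rfl
  | inv w _ hw =>
    have h1 : (w.toLinearEquiv : V →ₗ[ℝ] V) ∘ₗ ((w⁻¹ : V ≃ₗᵢ[ℝ] V).toLinearEquiv : V →ₗ[ℝ] V) =
      LinearMap.id := by
        ext y; exact w.apply_symm_apply y
    have h2 := congrArg LinearMap.det h1
    rw [LinearMap.det_comp, LinearMap.det_id] at h2
    have h3 := hw (w⁻¹ x)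
    have h4 : w (w⁻¹ x) = x := w.apply_symm_apply x
    rw [h4] at h3
    rw [h3, ← mul_assoc, mul_comm (LinearMap.det _), h2, one_mul]

end IsUnitNormal

end Pizza

/-! ### Vanishing of the low-degree moments -/

namespace Pizza

variable {V : Type*} [NormedAddCommGroup V] [InnerProductSpace ℝ V]

theorem signProd_eq_zero {ℋ : Finset (Submodule ℝ V)} {n : Submodule ℝ V → V}
    (hn : IsUnitNormal ℋ n) {x : V} (hx : x ∉ complement ℋ) : signProd ℋ n x = 0 := by
  simp only [complement, Set.mem_ofPred_eq, not_forall, not_not] at hx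
  obtain ⟨H, hH, hxH⟩ := hx
  exact Finset.prod_eq_zero hH (by simp [((hn H hH).2 x).1 hxH])

theorem abs_signProd_le_one (ℋ : Finset (Submodule ℝ V)) (n : Submodule ℝ V → V) (x : V) :
    |signProd ℋ n x| ≤ 1 := by
  rw [signProd, Finset.abs_prod]
  refine Finset.prod_le_one (fun _ _ => abs_nonneg _) fun H _ => ?_
  rcases SignType.sign ⟪n H, x⟫_ℝ with _ | _ | _ <;> simp

theorem signProd_smul (ℋ : Finset (Submodule ℝ V)) (n : Submodule ℝ V → V) {r : ℝ} (hr : 0 < r)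
    (x : V) : signProd ℋ n (r • x) = signProd ℋ n x := by
  simp [signProd, real_inner_smul_right, sign_mul, sign_pos hr]

theorem signProd_neg (ℋ : Finset (Submodule ℝ V)) (n : Submodule ℝ V → V) (x : V) :
    signProd ℋ n (-x) = (-1) ^ #ℋ * signProd ℋ n x := by
  simp only [signProd, inner_neg_right, ← Finset.prod_const, ← Finset.prod_mul_distrib]
  refine Finset.prod_congr rfl fun H _ => ?_
  rw [Left.sign_neg]
  simp

namespace IsUnitNormal

variable {ℋ : Finset (Submodule ℝ V)} {n : Submodule ℝ V → V}

/-- A line in a suitably generic direction meets the members of `ℋ` in distinct points. -/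
theorem exists_generic_direction (hn : IsUnitNormal ℋ n) {x : V} (hx : x ∈ complement ℋ) :
    ∃ y, (∀ H ∈ ℋ, ⟪n H, y⟫_ℝ ≠ 0) ∧ ∀ H ∈ ℋ, ∀ H' ∈ ℋ,
      ⟪n H, x⟫_ℝ * ⟪n H', y⟫_ℝ = ⟪n H', x⟫_ℝ * ⟪n H, y⟫_ℝ → H = H' := by
  classical
  -- The forbidden directions are those orthogonal to some `v p`: diagonal pairs encode the first
  -- requirement on `y`, the others the second.
  let v : Submodule ℝ V × Submodule ℝ V → V := fun p =>
    if p.1 = p.2 then n p.1 else ⟪n p.1, x⟫_ℝ • n p.2 - ⟪n p.2, x⟫_ℝ • n p.1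
  have hv : ∀ p ∈ ℋ ×ˢ ℋ, v p ≠ 0 := by
    rintro ⟨H, H'⟩ hp h0
    obtain ⟨hH, hH'⟩ := Finset.mem_product.1 hp
    dsimp only at hH hH'
    by_cases h : H = H'
    · simp only [v, h, if_true] at h0
      have := (hn H' hH').1
      rw [h0, norm_zero] at this
      exact zero_ne_one this
    · simp only [v, if_neg h] at h0
      have hx1 : ⟪n H, x⟫_ℝ ≠ 0 := fun h1 => hx H hH (((hn H hH).2 x).2 h1)
      have hx2 : ⟪n H', x⟫_ℝ ≠ 0 := fun h1 => hx H' hH' (((hn H' hH').2 x).2 h1)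
      refine h (Submodule.ext fun z => ?_)
      have h1 := congrArg (fun u => ⟪u, z⟫_ℝ) h0
      simp only [inner_sub_left, real_inner_smul_left, inner_zero_left] at h1
      rw [(hn H hH).2, (hn H' hH').2]
      constructor
      · intro h2
        rw [h2, mul_zero, sub_zero] at h1
        exact (mul_eq_zero.1 h1).resolve_left hx1
      · intro h2
        rw [h2, mul_zero, zero_sub, neg_eq_zero] at h1
        exact (mul_eq_zero.1 h1).resolve_left hx2
  let K : Submodule ℝ V × Submodule ℝ V → Submodule ℝ V := fun p => (innerₛₗ ℝ (v p)).ker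
  have hcov : (⊤ : Submodule ℝ V) ∉ (ℋ ×ˢ ℋ).image K := by
    intro h
    obtain ⟨p, hp, hpt⟩ := Finset.mem_image.1 h
    refine hv p hp ?_
    have h1 : v p ∈ K p := hpt ▸ Submodule.mem_top
    simpa [K] using h1
  -- A real vector space is not a finite union of proper subspaces.
  obtain ⟨y, hy⟩ := (Set.ne_univ_iff_exists_notMem _).1
    (Subspace.biUnion_ne_univ_of_top_notMem hcov)
  have hy' : ∀ p ∈ ℋ ×ˢ ℋ, ⟪v p, y⟫_ℝ ≠ 0 := by
    intro p hp h0
    refine hy (Set.mem_biUnion (x := K p) ?_ ?_)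
    · exact Finset.mem_coe.2 (Finset.mem_image_of_mem K hp)
    · simpa [K] using h0
  refine ⟨y, fun H hH => ?_, fun H hH H' hH' h => ?_⟩
  · simpa [v] using hy' (H, H) (Finset.mem_product.2 ⟨hH, hH⟩)
  · by_contra hne
    refine hy' (H, H') (Finset.mem_product.2 ⟨hH, hH'⟩) ?_
    simp only [v, if_neg hne, inner_sub_left, real_inner_smul_left]
    linarith

/-- The antisymmetrization of `⟪a, ·⟫ ^ d` vanishes for `d < #ℋ`: restricted to a generic line, it
is a polynomial of degree at most `d` with `#ℋ` distinct roots. -/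
theorem sum_det_mul_inner_pow_eq_zero [FiniteDimensional ℝ V] (hn : IsUnitNormal ℋ n)
    (hℋ : IsCoxeterArrangement ℋ)
    [Fintype (coxeterGroup ℋ)] {d : ℕ} (hd : d < #ℋ) (a : V) {x : V} (hx : x ∈ complement ℋ) :
    ∑ w : coxeterGroup ℋ, LinearMap.det ((w : V ≃ₗᵢ[ℝ] V).toLinearEquiv : V →ₗ[ℝ] V) *
      ⟪a, (w : V ≃ₗᵢ[ℝ] V) x⟫_ℝ ^ d = 0 := by
  classical
  let δ : coxeterGroup ℋ → ℝ := fun w =>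
    LinearMap.det ((w : V ≃ₗᵢ[ℝ] V).toLinearEquiv : V →ₗ[ℝ] V)
  -- Right multiplication by the reflection in `H` fixes `z` and negates the determinant, so the sum
  -- equals its own negative.
  have hvan : ∀ H ∈ ℋ, ∀ z ∈ H, ∑ w, δ w * ⟪a, (w : V ≃ₗᵢ[ℝ] V) z⟫_ℝ ^ d = 0 := by
    intro H hH z hz
    let s : coxeterGroup ℋ := ⟨H.reflection, Subgroup.subset_closure ⟨H, hH, rfl⟩⟩
    have hsz : (s : V ≃ₗᵢ[ℝ] V) z = z := H.reflection_mem_subspace_eq_self hz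
    have hδ : ∀ w, δ (w * s) = - δ w := by
      intro w
      have h1 := H.finrank_add_finrank_orthogonal
      have h2 := hℋ.isArrangement H hH
      have h4 := H.det_reflection
      rw [show finrank ℝ Hᗮ = 1 by omega, pow_one] at h4
      have : (((w * s : coxeterGroup ℋ) : V ≃ₗᵢ[ℝ] V).toLinearEquiv : V →ₗ[ℝ] V) =
        ((w : V ≃ₗᵢ[ℝ] V).toLinearEquiv : V →ₗ[ℝ] V) ∘ₗ
          (H.reflection.toLinearEquiv : V →ₗ[ℝ] V) := rfl
      simp only [δ]
      rw [this, LinearMap.det_comp]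
      erw [h4]
      ring
    have h1 := Equiv.sum_comp (Equiv.mulRight s)
      (fun w => δ w * ⟪a, (w : V ≃ₗᵢ[ℝ] V) z⟫_ℝ ^ d)
    have h2 : ∀ w, δ (Equiv.mulRight s w) *
        ⟪a, ((Equiv.mulRight s w : coxeterGroup ℋ) : V ≃ₗᵢ[ℝ] V) z⟫_ℝ ^ d =
        - (δ w * ⟪a, (w : V ≃ₗᵢ[ℝ] V) z⟫_ℝ ^ d) := by
      intro w
      have : ((w * s : coxeterGroup ℋ) : V ≃ₗᵢ[ℝ] V) z =
        (w : V ≃ₗᵢ[ℝ] V) ((s : V ≃ₗᵢ[ℝ] V) z) := rfl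
      rw [Equiv.coe_mulRight, hδ, this, hsz, neg_mul]
    rw [Finset.sum_congr rfl fun w _ => h2 w, Finset.sum_neg_distrib] at h1
    linarith
  obtain ⟨y, hy, hy'⟩ := hn.exists_generic_direction hx
  let p : Polynomial ℝ := ∑ w, Polynomial.C (δ w) *
    (Polynomial.C ⟪a, (w : V ≃ₗᵢ[ℝ] V) y⟫_ℝ * Polynomial.X +
      Polynomial.C ⟪a, (w : V ≃ₗᵢ[ℝ] V) x⟫_ℝ) ^ d
  have hp : ∀ t, p.eval t = ∑ w, δ w * ⟪a, (w : V ≃ₗᵢ[ℝ] V) (t • y + x)⟫_ℝ ^ d := by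
    intro t
    simp only [p, Polynomial.eval_finsetSum, Polynomial.eval_mul, Polynomial.eval_C,
      Polynomial.eval_pow, Polynomial.eval_add, Polynomial.eval_X, map_add, map_smul,
      inner_add_right, real_inner_smul_right, mul_comm t]
  have hdeg : p.natDegree ≤ d := by
    refine Polynomial.natDegree_sum_le_of_forall_le _ _ fun w _ => ?_
    refine (Polynomial.natDegree_C_mul_le _ _).trans (Polynomial.natDegree_pow_le.trans ?_)
    exact (Nat.mul_le_mul_left d Polynomial.natDegree_linear_le).trans_eq (mul_one d)
  have hp0 : p = 0 := by
    -- The roots are the parameters `t` at which the line `t • y + x` crosses the hyperplanes.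
    refine Polynomial.eq_zero_of_natDegree_lt_card_of_eval_eq_zero p
      (f := fun H : ℋ => - ⟪n H, x⟫_ℝ / ⟪n H, y⟫_ℝ) ?_ ?_ ?_
    · rintro ⟨H, hH⟩ ⟨H', hH'⟩ h
      have h1 := hy H hH
      have h2 := hy H' hH'
      dsimp only at h
      rw [div_eq_div_iff h1 h2] at h
      exact Subtype.ext (hy' H hH H' hH' (by linarith))
    · rintro ⟨H, hH⟩
      rw [hp]
      refine hvan H hH _ ?_
      rw [(hn H hH).2, inner_add_right, real_inner_smul_right, div_mul_cancel₀ _ (hy H hH)]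
      ring
    · rw [Fintype.card_coe]
      omega
  have := hp 0
  rw [hp0, Polynomial.eval_zero, zero_smul, zero_add] at this
  exact this.symm

end IsUnitNormal

variable [FiniteDimensional ℝ V] [MeasurableSpace V] [BorelSpace V]

theorem measurable_signProd (ℋ : Finset (Submodule ℝ V)) (n : Submodule ℝ V → V) :
    Measurable (signProd ℋ n) := by
  have hs : Measurable fun t : ℝ => ((SignType.sign t : SignType) : ℝ) := by
    have : (fun t : ℝ => ((SignType.sign t : SignType) : ℝ)) =
        fun t => if 0 < t then 1 else if t < 0 then -1 else 0 := by
      ext t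
      rw [sign_apply]
      split_ifs <;> simp
    rw [this]
    exact Measurable.ite measurableSet_Ioi measurable_const
      (Measurable.ite measurableSet_Iio measurable_const measurable_const)
  unfold signProd
  exact Finset.measurable_fun_prod _ fun H _ => hs.comp (by fun_prop)

theorem integrableOn_signProd_mul (ℋ : Finset (Submodule ℝ V)) (n : Submodule ℝ V → V)
    {f : V → ℝ} (hf : Continuous f) (a : V) (R : ℝ) :
    IntegrableOn (fun x => signProd ℋ n x * f x) (Metric.closedBall a R) := by
  refine Integrable.bdd_mul (c := 1) ?_ (measurable_signProd ℋ n).aestronglyMeasurable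
    (ae_of_all _ fun x => abs_signProd_le_one ℋ n x)
  exact hf.continuousOn.integrableOn_compact (isCompact_closedBall a R)

/-- The unit ball and the volume are invariant under each `w`, so the integral is unchanged when the
power is replaced by `det w * ⟪a, w x⟫ ^ d`. Summing over the group leaves an integrand that
vanishes everywhere. -/
theorem setIntegral_signProd_mul_inner_pow_eq_zero {ℋ : Finset (Submodule ℝ V)}
    {n : Submodule ℝ V → V} (hn : IsUnitNormal ℋ n) (hℋ : IsCoxeterArrangement ℋ) {d : ℕ}
    (hd : d < #ℋ) (a : V) :
    ∫ x in Metric.closedBall (0 : V) 1, signProd ℋ n x * ⟪a, x⟫_ℝ ^ d = 0 := by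
  have := hℋ.finite_coxeterGroup
  have := Fintype.ofFinite (coxeterGroup ℋ)
  set I := ∫ x in Metric.closedBall (0 : V) 1, signProd ℋ n x * ⟪a, x⟫_ℝ ^ d with hI
  have hw : ∀ w : coxeterGroup ℋ, ∫ x in Metric.closedBall (0 : V) 1, signProd ℋ n x *
      (LinearMap.det ((w : V ≃ₗᵢ[ℝ] V).toLinearEquiv : V →ₗ[ℝ] V) *
        ⟪a, (w : V ≃ₗᵢ[ℝ] V) x⟫_ℝ ^ d) = I := by
    rintro ⟨w, hw⟩
    have h1 := w.measurePreserving.setIntegral_preimage_emb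
      w.toHomeomorph.measurableEmbedding
      (fun x => signProd ℋ n x * ⟪a, x⟫_ℝ ^ d) (Metric.closedBall 0 1)
    have h2 : w ⁻¹' Metric.closedBall 0 1 = Metric.closedBall 0 1 := by
      ext x; simp
    rw [h2] at h1
    rw [hI, ← h1]
    refine integral_congr_ae (ae_of_all _ fun x => ?_)
    simp only [hn.signProd_coxeterGroup hℋ hw]
    ring
  have h1 : ∑ w : coxeterGroup ℋ, I = 0 := by
    rw [← Finset.sum_congr rfl fun w _ => hw w, ← integral_finsetSum]
    · refine integral_eq_zero_of_ae (ae_of_all _ fun x => ?_)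
      simp only [← Finset.mul_sum, Pi.zero_apply]
      by_cases hx : x ∈ complement ℋ
      · rw [hn.sum_det_mul_inner_pow_eq_zero hℋ hd a hx, mul_zero]
      · rw [signProd_eq_zero hn hx, zero_mul]
    · intro w _
      exact integrableOn_signProd_mul ℋ n (by fun_prop) 0 1
  rw [Finset.sum_const, nsmul_eq_mul, mul_eq_zero] at h1
  exact h1.resolve_left (by simp)

end Pizza

/-! ### Polar coordinates and sphere moments -/

namespace Pizza

variable {V : Type*} [NormedAddCommGroup V] [InnerProductSpace ℝ V]
-- Membership reads `(r - t)² ≤ R² - ‖a‖² + t²` with `t = ⟪a, u⟫`. Since `‖a‖ ≤ R`, the smaller root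
-- is nonpositive and only the upper bound on `r` matters.
theorem mem_closedBall_smul_iff {a u : V} (hu : ‖u‖ = 1) {R : ℝ} (hR : ‖a‖ ≤ R) {r : ℝ}
    (hr : 0 < r) : r • u ∈ Metric.closedBall a R ↔
      r ≤ ⟪a, u⟫_ℝ + √(R ^ 2 - ‖a‖ ^ 2 + ⟪a, u⟫_ℝ ^ 2) := by
  have hR0 : 0 ≤ R := (norm_nonneg a).trans hR
  have hc : 0 ≤ R ^ 2 - ‖a‖ ^ 2 := by nlinarith [norm_nonneg a]
  set t := ⟪a, u⟫_ℝ
  have h1 : ‖r • u - a‖ ^ 2 = r ^ 2 - 2 * (r * t) + ‖a‖ ^ 2 := by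
    rw [norm_sub_sq_real, norm_smul, hu, mul_one, Real.norm_of_nonneg hr.le, real_inner_smul_left,
      real_inner_comm]
  rw [Metric.mem_closedBall, dist_eq_norm, ← pow_le_pow_iff_left₀ (norm_nonneg _) hR0 two_ne_zero,
    h1, ← sub_le_iff_le_add']
  have hs : 0 ≤ √(R ^ 2 - ‖a‖ ^ 2 + t ^ 2) := Real.sqrt_nonneg _
  have hs2 : √(R ^ 2 - ‖a‖ ^ 2 + t ^ 2) ^ 2 = R ^ 2 - ‖a‖ ^ 2 + t ^ 2 :=
    Real.sq_sqrt (by positivity)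
  constructor
  · intro h
    refine Real.le_sqrt_of_sq_le ?_
    nlinarith
  · intro h
    have h2 := Real.abs_le_sqrt (x := t) (y := R ^ 2 - ‖a‖ ^ 2 + t ^ 2) (by linarith)
    have h3 : -√(R ^ 2 - ‖a‖ ^ 2 + t ^ 2) ≤ r - t := by linarith [le_abs_self t]
    have h4 := sq_le_sq' h3 h
    rw [hs2] at h4
    linarith

variable [FiniteDimensional ℝ V] [MeasurableSpace V] [BorelSpace V]

/-- Integration in polar coordinates. -/
theorem integral_eq_integral_toSphere [Nontrivial V] (μ : Measure V) [μ.IsAddHaarMeasure]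
    {f : V → ℝ} (hf : Integrable f μ) :
    ∫ x, f x ∂μ = ∫ u, (∫ r in Set.Ioi (0 : ℝ), r ^ (finrank ℝ V - 1) * f (r • (u : V)))
      ∂μ.toSphere := by
  have hmp := μ.measurePreserving_homeomorphUnitSphereProd
  have hemb := (homeomorphUnitSphereProd V).measurableEmbedding
  let g : Metric.sphere (0 : V) 1 × Set.Ioi (0 : ℝ) → ℝ := fun p => f ((p.2 : ℝ) • (p.1 : V))
  have hg : ∀ x : ({0}ᶜ : Set V), g (homeomorphUnitSphereProd V x) = f x := by
    intro x
    have : ‖(x : V)‖ ≠ 0 := norm_ne_zero_iff.2 x.2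
    simp [g, smul_smul, this]
  have hgi : Integrable g (μ.toSphere.prod (Measure.volumeIoiPow (finrank ℝ V - 1))) := by
    rw [← hmp.integrable_comp_emb hemb]
    have : g ∘ homeomorphUnitSphereProd V = f ∘ ((↑) : ({0}ᶜ : Set V) → V) := funext hg
    rw [this, ← integrableOn_iff_comap_subtypeVal (measurableSet_singleton _).compl]
    exact hf.integrableOn
  calc
    ∫ x, f x ∂μ = ∫ x : ({(0)}ᶜ : Set V), f x.1 ∂(μ.comap (↑)) := by
      rw [integral_subtype_comap (measurableSet_singleton _).compl f, restrict_compl_singleton]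
    _ = ∫ p, g p ∂μ.toSphere.prod (Measure.volumeIoiPow (finrank ℝ V - 1)) := by
      rw [← hmp.integral_comp hemb]
      simp_rw [hg]
    _ = ∫ u, ∫ r, g (u, r) ∂Measure.volumeIoiPow (finrank ℝ V - 1) ∂μ.toSphere :=
      integral_prod _ hgi
    _ = _ := by
      refine integral_congr_ae (ae_of_all _ fun u => ?_)
      simp only [Measure.volumeIoiPow, ENNReal.ofReal]
      rw [integral_withDensity_eq_integral_smul,
        integral_subtype_comap measurableSet_Ioi
          fun a ↦ Real.toNNReal (a ^ (finrank ℝ V - 1)) • f (a • (u : V)),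
        setIntegral_congr_fun measurableSet_Ioi fun x hx ↦ ?_]
      · rw [NNReal.smul_def, Real.coe_toNNReal _ (pow_nonneg hx.out.le _), smul_eq_mul]
      · exact (measurable_subtype_coe.pow_const _).real_toNNReal

variable {ℋ : Finset (Submodule ℝ V)} {n : Submodule ℝ V → V}

/-- The moments of `signProd` on the unit sphere. -/
def sphereMoment (ℋ : Finset (Submodule ℝ V)) (n : Submodule ℝ V → V) (a : V) (d : ℕ) : ℝ :=
  ∫ u, signProd ℋ n (u : V) * ⟪a, (u : V)⟫_ℝ ^ d ∂(volume : Measure V).toSphere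

theorem integral_Ioi_pow_mul_ite {k : ℕ} {b c : ℝ} (hb : 0 ≤ b) :
    ∫ r in Set.Ioi (0 : ℝ), r ^ k * (if r ≤ b then c else 0) = c * (b ^ (k + 1) / (k + 1)) := by
  have h1 : ∀ r : ℝ, r ^ k * (if r ≤ b then c else 0) =
      (Set.Iic b).indicator (fun r => c * r ^ k) r := by
    intro r
    by_cases h : r ≤ b <;> simp [h, mul_comm]
  simp_rw [h1]
  rw [setIntegral_indicator measurableSet_Iic, Set.Ioi_inter_Iic,
    ← intervalIntegral.integral_of_le hb, intervalIntegral.integral_const_mul, integral_pow]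
  simp

/-- By homogeneity, the integral over the unit ball is the sphere moment times a positive radial
factor. -/
theorem sphereMoment_eq_zero [Nontrivial V] (hn : IsUnitNormal ℋ n)
    (hℋ : IsCoxeterArrangement ℋ) {d : ℕ} (hd : d < #ℋ) (a : V) : sphereMoment ℋ n a d = 0 := by
  have h0 := setIntegral_signProd_mul_inner_pow_eq_zero hn hℋ hd a
  have hi := integrableOn_signProd_mul ℋ n (f := fun x => ⟪a, x⟫_ℝ ^ d) (by fun_prop) 0 1
  rw [← integral_indicator measurableSet_closedBall,
    integral_eq_integral_toSphere _ (hi.integrable_indicator measurableSet_closedBall)] at h0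
  have h1 : ∀ u : Metric.sphere (0 : V) 1,
      ∫ r in Set.Ioi (0 : ℝ), r ^ (finrank ℝ V - 1) * (Metric.closedBall (0 : V) 1).indicator
        (fun x => signProd ℋ n x * ⟪a, x⟫_ℝ ^ d) (r • (u : V)) =
      (signProd ℋ n (u : V) * ⟪a, (u : V)⟫_ℝ ^ d) *
        (1 ^ (finrank ℝ V - 1 + d + 1) / ((finrank ℝ V - 1 + d : ℕ) + 1)) := by
    intro u
    rw [← integral_Ioi_pow_mul_ite zero_le_one]
    refine setIntegral_congr_fun measurableSet_Ioi fun r (hr : 0 < r) => ?_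
    have hu : ‖(u : V)‖ = 1 := by simp
    have hm : r • (u : V) ∈ Metric.closedBall (0 : V) 1 ↔ r ≤ 1 := by
      rw [mem_closedBall_zero_iff, norm_smul, hu, mul_one, Real.norm_of_nonneg hr.le]
    by_cases h : r ≤ 1
    · rw [Set.indicator_of_mem (hm.2 h), if_pos h, signProd_smul ℋ n hr, real_inner_smul_right]
      ring
    · rw [Set.indicator_of_notMem (fun h' => h (hm.1 h')), if_neg h, mul_zero, mul_zero]
  simp_rw [h1] at h0
  rw [integral_mul_const] at h0
  refine (mul_eq_zero.1 h0).resolve_right ?_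
  positivity

theorem integrable_toSphere_signProd_mul {f : V → ℝ} (hf : Continuous f) :
    Integrable (fun u : Metric.sphere (0 : V) 1 => signProd ℋ n (u : V) * f u)
      (volume : Measure V).toSphere := by
  refine Integrable.bdd_mul (c := 1) ?_
    ((measurable_signProd ℋ n).comp measurable_subtype_coe).aestronglyMeasurable
    (ae_of_all _ fun x => abs_signProd_le_one ℋ n x)
  have hc : Continuous fun u : Metric.sphere (0 : V) 1 => f u := hf.comp continuous_subtype_val
  exact hc.integrable_of_hasCompactSupport (HasCompactSupport.of_compactSpace _)

/-- All moments below degree `d ≤ #ℋ` vanish, so only the coefficient of degree `d` contributes. -/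
theorem integral_signProd_mul_polynomial [Nontrivial V] (hn : IsUnitNormal ℋ n)
    (hℋ : IsCoxeterArrangement ℋ) {d : ℕ} (hd : d ≤ #ℋ) {p : Polynomial ℝ} (hp : p.natDegree ≤ d)
    (a : V) :
    ∫ u, signProd ℋ n (u : V) * p.eval ⟪a, (u : V)⟫_ℝ ∂(volume : Measure V).toSphere =
      p.coeff d * sphereMoment ℋ n a d := by
  simp_rw [Polynomial.eval_eq_sum_range' (Nat.lt_succ_of_le hp), Finset.mul_sum]
  rw [integral_finsetSum _ fun i _ =>
    integrable_toSphere_signProd_mul (f := fun x => p.coeff i * ⟪a, x⟫_ℝ ^ i) (by fun_prop)]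
  simp_rw [mul_left_comm _ (p.coeff _)]
  simp_rw [integral_const_mul]
  rw [Finset.sum_range_succ, Finset.sum_eq_zero, zero_add]
  · rfl
  · intro i hi
    have := sphereMoment_eq_zero hn hℋ ((Finset.mem_range.1 hi).trans_le hd) a
    rw [sphereMoment] at this
    rw [this, mul_zero]

/-- Along each ray the sign product is constant, so the radial integral is that of `r ^ (finrank ℝ V
- 1)` up to the exit radius. -/
theorem setIntegral_closedBall_signProd [Nontrivial V] (ℋ : Finset (Submodule ℝ V))
    (n : Submodule ℝ V → V) {a : V} {R : ℝ} (hR : ‖a‖ ≤ R) :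
    ∫ x in Metric.closedBall a R, signProd ℋ n x =
      (finrank ℝ V : ℝ)⁻¹ * ∫ u, signProd ℋ n (u : V) *
        (⟪a, (u : V)⟫_ℝ + √(R ^ 2 - ‖a‖ ^ 2 + ⟪a, (u : V)⟫_ℝ ^ 2)) ^ finrank ℝ V
          ∂(volume : Measure V).toSphere := by
  have hR0 : 0 ≤ R := (norm_nonneg a).trans hR
  have hc : 0 ≤ R ^ 2 - ‖a‖ ^ 2 := by nlinarith [norm_nonneg a]
  have hi := integrableOn_signProd_mul ℋ n (f := fun _ => 1) continuous_const a R
  simp only [mul_one] at hi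
  have hpos : 0 < finrank ℝ V := finrank_pos
  rw [← integral_indicator measurableSet_closedBall,
    integral_eq_integral_toSphere _ (hi.integrable_indicator measurableSet_closedBall),
    ← integral_const_mul]
  refine integral_congr_ae (ae_of_all _ fun u => ?_)
  have hu : ‖(u : V)‖ = 1 := by simp
  have hb : 0 ≤ ⟪a, (u : V)⟫_ℝ + √(R ^ 2 - ‖a‖ ^ 2 + ⟪a, (u : V)⟫_ℝ ^ 2) := by
    have := Real.abs_le_sqrt (x := ⟪a, (u : V)⟫_ℝ)
      (y := R ^ 2 - ‖a‖ ^ 2 + ⟪a, (u : V)⟫_ℝ ^ 2) (by linarith)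
    linarith [neg_abs_le ⟪a, (u : V)⟫_ℝ]
  have h1 := integral_Ioi_pow_mul_ite (k := finrank ℝ V - 1) (c := signProd ℋ n (u : V)) hb
  rw [Nat.sub_add_cancel hpos, Nat.cast_pred hpos, sub_add_cancel] at h1
  beta_reduce
  rw [mul_left_comm, inv_mul_eq_div, ← h1]
  refine setIntegral_congr_fun measurableSet_Ioi fun r (hr : 0 < r) => ?_
  have hm := mem_closedBall_smul_iff hu hR hr
  by_cases h : r • (u : V) ∈ Metric.closedBall a R
  · rw [Set.indicator_of_mem h, if_pos (hm.1 h), signProd_smul ℋ n hr]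
  · rw [Set.indicator_of_notMem h, if_neg (fun h' => h (hm.2 h'))]

end Pizza

/-! ### Chambers and their signs -/

namespace Pizza

variable {V : Type*} [NormedAddCommGroup V] [InnerProductSpace ℝ V]
variable {ℋ : Finset (Submodule ℝ V)} {n : Submodule ℝ V → V}

theorem subset_complement_of_mem_chambers {T : Set V} (hT : T ∈ chambers ℋ) :
    T ⊆ complement ℋ := by
  obtain ⟨x, _, rfl⟩ := hT
  exact connectedComponentIn_subset _ _

namespace IsUnitNormal

theorem inner_ne_zero (hn : IsUnitNormal ℋ n) {x : V} (hx : x ∈ complement ℋ)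
    {H : Submodule ℝ V} (hH : H ∈ ℋ) : ⟪n H, x⟫_ℝ ≠ 0 :=
  fun h => hx H hH (((hn H hH).2 x).2 h)

/-- A chamber is connected and the form has no zero on it, so the intermediate value theorem forbids
a sign change. -/
theorem inner_mul_inner_pos (hn : IsUnitNormal ℋ n) {T : Set V} (hT : T ∈ chambers ℋ)
    {H : Submodule ℝ V} (hH : H ∈ ℋ) {x y : V} (hx : x ∈ T) (hy : y ∈ T) :
    0 < ⟪n H, x⟫_ℝ * ⟪n H, y⟫_ℝ := by
  have hsub := subset_complement_of_mem_chambers hT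
  have hpre : IsPreconnected T := by
    obtain ⟨z, _, rfl⟩ := hT
    exact isPreconnected_connectedComponentIn
  have hc : ContinuousOn (fun z => ⟪n H, z⟫_ℝ) T := by fun_prop
  by_contra! hle
  have h0 : (0 : ℝ) ∈ (fun z => ⟪n H, z⟫_ℝ) '' T := by
    rcases mul_nonpos_iff.1 hle with h | h
    · exact hpre.intermediate_value hy hx hc ⟨h.2, h.1⟩
    · exact hpre.intermediate_value hx hy hc ⟨h.1, h.2⟩
  obtain ⟨z, hz, hz0⟩ := h0
  exact hn.inner_ne_zero (hsub hz) hH hz0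

theorem oppositeSides_iff (hn : IsUnitNormal ℋ n) {T₁ T₂ : Set V} (hT₁ : T₁ ∈ chambers ℋ)
    (hT₂ : T₂ ∈ chambers ℋ) {H : Submodule ℝ V} (hH : H ∈ ℋ) {x y : V} (hx : x ∈ T₁)
    (hy : y ∈ T₂) : OppositeSides H T₁ T₂ ↔ ⟪n H, x⟫_ℝ * ⟪n H, y⟫_ℝ < 0 := by
  constructor
  · rintro ⟨e, he, h1, h2⟩
    -- A normal vector of `H` is a multiple of `n H`.
    have key : ∀ z, ⟪e, z⟫_ℝ = ⟪n H, z⟫_ℝ * ⟪e, n H⟫_ℝ := by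
      intro z
      have hz : z - ⟪n H, z⟫_ℝ • n H ∈ H := by
        rw [(hn H hH).2, inner_sub_right, real_inner_smul_right, real_inner_self_eq_norm_sq,
          (hn H hH).1]
        ring
      have h3 := H.inner_left_of_mem_orthogonal hz he
      rwa [inner_sub_right, real_inner_smul_right, sub_eq_zero] at h3
    have h3 := h1 x hx
    have h4 := h2 y hy
    have h5 := mul_neg_of_neg_of_pos h3 h4
    rw [key x, key y] at h5
    by_contra! h6
    nlinarith [mul_nonneg h6 (sq_nonneg ⟪e, n H⟫_ℝ)]
  · intro h
    -- The scalar orients the normal so that it is negative on the side of `x`.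
    refine ⟨-⟪n H, x⟫_ℝ • n H, ?_, fun z hz => ?_, fun z hz => ?_⟩
    · refine Submodule.smul_mem _ _ ((Submodule.mem_orthogonal' _ _).2 fun u hu => ?_)
      exact ((hn H hH).2 u).1 hu
    · rw [real_inner_smul_left]
      linarith [hn.inner_mul_inner_pos hT₁ hH hx hz]
    · rw [real_inner_smul_left]
      have h1 := mul_neg_of_neg_of_pos h (hn.inner_mul_inner_pos hT₂ hH hy hz)
      by_contra! h2
      nlinarith [mul_nonneg (neg_nonneg.2 h2) (sq_nonneg ⟪n H, y⟫_ℝ),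
        sq_nonneg ⟪n H, y⟫_ℝ]

theorem chamberSign_eq (hn : IsUnitNormal ℋ n) {T₁ T₂ : Set V} (hT₁ : T₁ ∈ chambers ℋ)
    (hT₂ : T₂ ∈ chambers ℋ) {x y : V} (hx : x ∈ T₁) (hy : y ∈ T₂) :
    chamberSign ℋ T₁ T₂ = signProd ℋ n x * signProd ℋ n y := by
  classical
  rw [chamberSign, separationSet, ← Finset.prod_const, Finset.prod_filter, signProd, signProd,
    ← Finset.prod_mul_distrib]
  refine Finset.prod_congr rfl fun H hH => ?_
  rw [← SignType.coe_mul, ← sign_mul]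
  by_cases h : OppositeSides H T₁ T₂
  · rw [if_pos h, sign_neg ((hn.oppositeSides_iff hT₁ hT₂ hH hx hy).1 h)]
    simp
  · have h1 := mt (hn.oppositeSides_iff hT₁ hT₂ hH hx hy).2 h
    have h2 : 0 < ⟪n H, x⟫_ℝ * ⟪n H, y⟫_ℝ := (not_lt.1 h1).lt_of_ne'
      (mul_ne_zero (hn.inner_ne_zero (subset_complement_of_mem_chambers hT₁ hx) hH)
        (hn.inner_ne_zero (subset_complement_of_mem_chambers hT₂ hy) hH))
    rw [if_neg h, sign_pos h2]
    simp

theorem signProd_eq_of_mem_chamber (hn : IsUnitNormal ℋ n) {T : Set V} (hT : T ∈ chambers ℋ)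
    {x y : V} (hx : x ∈ T) (hy : y ∈ T) : signProd ℋ n x = signProd ℋ n y := by
  refine Finset.prod_congr rfl fun H hH => ?_
  rcases mul_pos_iff.1 (hn.inner_mul_inner_pos hT hH hx hy) with h | h
  · rw [sign_pos h.1, sign_pos h.2]
  · rw [sign_neg h.1, sign_neg h.2]

end IsUnitNormal

theorem pairwise_disjoint_chambers (ℋ : Finset (Submodule ℝ V)) :
    (chambers ℋ).PairwiseDisjoint id := by
  rintro _ ⟨x, hx, rfl⟩ _ ⟨y, hy, rfl⟩ hne
  refine Set.disjoint_left.2 fun z hzx hzy => hne ?_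
  rw [connectedComponentIn_eq hzx, connectedComponentIn_eq hzy]

theorem biUnion_chambers (ℋ : Finset (Submodule ℝ V)) : ⋃ T ∈ chambers ℋ, T = complement ℋ := by
  refine Set.Subset.antisymm (Set.iUnion₂_subset fun T hT => subset_complement_of_mem_chambers hT)
    fun x hx => Set.mem_biUnion (x := connectedComponentIn (complement ℋ) x) ⟨x, hx, rfl⟩
      (mem_connectedComponentIn hx)

variable [FiniteDimensional ℝ V]

theorem isOpen_complement (ℋ : Finset (Submodule ℝ V)) : IsOpen (complement ℋ) := by
  have : complement ℋ = ⋂ H ∈ ℋ, (H : Set V)ᶜ := by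
    ext x; simp [complement]
  rw [this]
  exact isOpen_biInter_finset fun H _ => H.closed_of_finiteDimensional.isOpen_compl

theorem isOpen_of_mem_chambers {T : Set V} (hT : T ∈ chambers ℋ) : IsOpen T := by
  obtain ⟨x, _, rfl⟩ := hT
  exact (isOpen_complement ℋ).connectedComponentIn

variable [MeasurableSpace V] [BorelSpace V]

/-- The constant is the sign of the base chamber. The hyperplanes contribute nothing because the
sign product is zero there. -/
theorem exists_pizzaQuantity_eq_mul_integral (hℋ : IsArrangement ℋ) (hn : IsUnitNormal ℋ n)
    {T₀ : Set V} (hT₀ : T₀ ∈ chambers ℋ) :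
    ∃ c : ℝ, ∀ (a : V) (R : ℝ), pizzaQuantity ℋ T₀ (Metric.closedBall a R) =
      c * ∫ x in Metric.closedBall a R, signProd ℋ n x := by
  classical
  have hne : ∀ T ∈ chambers ℋ, T.Nonempty := by
    rintro _ ⟨x, hx, rfl⟩
    exact ⟨x, mem_connectedComponentIn hx⟩
  obtain ⟨x₀, hx₀⟩ := hne T₀ hT₀
  refine ⟨signProd ℋ n x₀, fun a R => ?_⟩
  set K := Metric.closedBall a R
  have hK : MeasurableSet K := measurableSet_closedBall
  have hfin := chambers_finite hℋ
  have hi : IntegrableOn (signProd ℋ n) K := by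
    have := integrableOn_signProd_mul ℋ n (f := fun _ => 1) continuous_const a R
    simpa only [mul_one] using this
  have hU : ∫ x in K, signProd ℋ n x =
      ∫ x in ⋃ T ∈ hfin.toFinset, K ∩ T, signProd ℋ n x := by
    have h1 : ⋃ T ∈ hfin.toFinset, K ∩ T = K ∩ complement ℋ := by
      simp only [Set.Finite.mem_toFinset, ← Set.inter_iUnion₂, biUnion_chambers]
    rw [h1]
    exact setIntegral_eq_of_subset_of_forall_sdiff_eq_zero hK Set.inter_subset_left
      fun x hx => signProd_eq_zero hn fun hx' => hx.2 ⟨hx.1, hx'⟩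
  rw [hU, integral_biUnion_finset, Finset.mul_sum, pizzaQuantity,
    finsum_mem_eq_finite_toFinset_sum _ hfin]
  · refine Finset.sum_congr rfl fun T hT => ?_
    rw [Set.Finite.mem_toFinset] at hT
    obtain ⟨y, hy⟩ := hne T hT
    have hm : MeasurableSet (K ∩ T) :=
      hK.inter (isOpen_of_mem_chambers hT).measurableSet
    rw [setIntegral_congr_fun hm (g := fun _ => signProd ℋ n y) fun x hx =>
      hn.signProd_eq_of_mem_chamber hT hx.2 hy, setIntegral_const, hn.chamberSign_eq hT₀ hT hx₀ hy,
      smul_eq_mul]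
    ring
  · intro T hT
    rw [Set.Finite.mem_toFinset] at hT
    exact hK.inter (isOpen_of_mem_chambers hT).measurableSet
  · intro T hT T' hT' h
    rw [Finset.mem_coe, Set.Finite.mem_toFinset] at hT hT'
    exact (pairwise_disjoint_chambers ℋ hT hT' h).mono Set.inter_subset_right
      Set.inter_subset_right
  · exact fun T _ => hi.mono_set Set.inter_subset_left

end Pizza

/-! ### Conjugate power sums and Taylor approximation -/

namespace Pizza

/-- The polynomials in `t` that represent `(t + √(c + t²)) ^ m + (t - √(c + t²)) ^ m`. -/
def conjPowSum (c : ℝ) : ℕ → Polynomial ℝ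
  | 0 => Polynomial.C 2
  | 1 => Polynomial.C 2 * Polynomial.X
  | m + 2 => Polynomial.C 2 * (Polynomial.X * conjPowSum c (m + 1)) +
      Polynomial.C c * conjPowSum c m

/-- The numbers `t ± s` are the roots of `z² = 2 t z + c`, whence the recursion. -/
theorem eval_conjPowSum {c t s : ℝ} (hs : s ^ 2 = c + t ^ 2) (m : ℕ) :
    (conjPowSum c m).eval t = (t + s) ^ m + (t - s) ^ m := by
  induction m using Nat.twoStepInduction with
  | zero => simp [conjPowSum]; norm_num
  | one => simp [conjPowSum]; ring
  | more m h1 h2 =>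
    simp only [conjPowSum, Polynomial.eval_add, Polynomial.eval_mul, Polynomial.eval_C,
      Polynomial.eval_X, h1, h2]
    obtain rfl : c = s ^ 2 - t ^ 2 := by linarith
    ring

theorem natDegree_conjPowSum_le (c : ℝ) (m : ℕ) : (conjPowSum c m).natDegree ≤ m := by
  induction m using Nat.twoStepInduction with
  | zero => simp [conjPowSum]
  | one => exact (Polynomial.natDegree_C_mul_le _ _).trans Polynomial.natDegree_X_le
  | more m h1 h2 =>
    refine Polynomial.natDegree_add_le_of_degree_le ?_ ?_
    · refine (Polynomial.natDegree_C_mul_le _ _).trans (Polynomial.natDegree_mul_le.trans ?_)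
      have := Polynomial.natDegree_X_le (R := ℝ)
      omega
    · exact (Polynomial.natDegree_C_mul_le _ _).trans (by omega)

/-- In the recursion, the term carrying `c` has degree two too low to reach the top coefficient.
This is what makes the result independent of `R`. -/
theorem coeff_conjPowSum (c c' : ℝ) (m : ℕ) :
    (conjPowSum c m).coeff m = (conjPowSum c' m).coeff m := by
  induction m using Nat.twoStepInduction with
  | zero => rfl
  | one => rfl
  | more m _ h2 =>
    have h : ∀ b : ℝ, (conjPowSum b m).coeff (m + 2) = 0 := fun b =>
      Polynomial.coeff_eq_zero_of_natDegree_lt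
        ((natDegree_conjPowSum_le b m).trans_lt (by omega))
    simp only [conjPowSum, Polynomial.coeff_add, Polynomial.coeff_C_mul, Polynomial.coeff_X_mul,
      h, h2, mul_zero]

theorem exists_polynomial_isLittleO (m : ℕ) : ∃ p : Polynomial ℝ, p.natDegree ≤ m ∧
    (fun y : ℝ => (y + √(1 + y ^ 2)) ^ m - p.eval y) =o[𝓝 0] fun y => y ^ m := by
  have hf : ContDiff ℝ m fun y : ℝ => (y + √(1 + y ^ 2)) ^ m := by
    refine (contDiff_id.add (ContDiff.sqrt (by fun_prop) fun y => ?_)).pow m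
    positivity
  refine ⟨∑ k ∈ Finset.range (m + 1), Polynomial.C (((k.factorial : ℝ)⁻¹) *
    iteratedDerivWithin k (fun y : ℝ => (y + √(1 + y ^ 2)) ^ m) Set.univ 0) * Polynomial.X ^ k,
    ?_, ?_⟩
  · refine Polynomial.natDegree_sum_le_of_forall_le _ _ fun k hk => ?_
    exact (Polynomial.natDegree_C_mul_X_pow_le _ _).trans
      (Nat.lt_succ_iff.1 (Finset.mem_range.1 hk))
  · have := taylor_isLittleO_univ (x₀ := 0) hf
    simp only [sub_zero, taylor_within_apply, smul_eq_mul] at this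
    refine this.congr_left fun y => ?_
    simp only [Polynomial.eval_finsetSum, Polynomial.eval_mul, Polynomial.eval_C,
      Polynomial.eval_pow, Polynomial.eval_X]
    congr 1
    exact Finset.sum_congr rfl fun k _ => by ring

/-! ### The integral for equal parities and for large radius -/

variable {V : Type*} [NormedAddCommGroup V] [InnerProductSpace ℝ V]
variable [FiniteDimensional ℝ V] [MeasurableSpace V] [BorelSpace V] [Nontrivial V]
variable {ℋ : Finset (Submodule ℝ V)} {n : Submodule ℝ V → V}

/-- In the case of equal parities, averaging over the antipodal map makes the integrand a
polynomial. -/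
theorem two_mul_setIntegral_signProd (hn : IsUnitNormal ℋ n) (hℋ : IsCoxeterArrangement ℋ)
    (hcard : finrank ℝ V ≤ #ℋ) (hpar : #ℋ ≡ finrank ℝ V [MOD 2]) {a : V} {R : ℝ} (hR : ‖a‖ ≤ R) :
    2 * ∫ x in Metric.closedBall a R, signProd ℋ n x =
      (finrank ℝ V : ℝ)⁻¹ * ((conjPowSum 0 (finrank ℝ V)).coeff (finrank ℝ V) *
        sphereMoment ℋ n a (finrank ℝ V)) := by
  have hneg : ∫ x in Metric.closedBall a R, signProd ℋ n x =
      (-1) ^ #ℋ * ∫ x in Metric.closedBall (-a) R, signProd ℋ n x := by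
    have h1 := (Measure.measurePreserving_neg (volume : Measure V)).setIntegral_preimage_emb
      (Homeomorph.neg V).measurableEmbedding (signProd ℋ n) (Metric.closedBall a R)
    have h2 : (Neg.neg : V → V) ⁻¹' Metric.closedBall a R = Metric.closedBall (-a) R := by
      ext x
      rw [Set.mem_preimage, Metric.mem_closedBall, Metric.mem_closedBall, ← dist_neg_neg, neg_neg]
    rw [← h1, h2, ← integral_const_mul]
    simp_rw [signProd_neg]
  have hsgn : (-1 : ℝ) ^ #ℋ = (-1) ^ finrank ℝ V := by
    rw [neg_one_pow_eq_pow_mod_two, hpar, ← neg_one_pow_eq_pow_mod_two]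
  set c := R ^ 2 - ‖a‖ ^ 2 with hc
  have hc0 : 0 ≤ c := by nlinarith [norm_nonneg a]
  have hcont : ∀ b : V, Continuous fun x : V =>
      (⟪b, x⟫_ℝ + √(c + ⟪b, x⟫_ℝ ^ 2)) ^ finrank ℝ V := fun b => by fun_prop
  rw [two_mul]
  nth_rewrite 2 [hneg]
  rw [setIntegral_closedBall_signProd ℋ n hR,
    setIntegral_closedBall_signProd ℋ n ((norm_neg a).trans_le hR), norm_neg, ← hc,
    mul_left_comm, ← mul_add, ← integral_const_mul,
    ← integral_add (integrable_toSphere_signProd_mul (hcont a))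
      ((integrable_toSphere_signProd_mul (hcont (-a))).const_mul _),
    coeff_conjPowSum 0 c, ← integral_signProd_mul_polynomial hn hℋ hcard
      (natDegree_conjPowSum_le c _)]
  congr 1
  -- Equal parity lets the sign be absorbed: `(-1) ^ m * (-t + s) ^ m = (t - s) ^ m`, where `m` is
  -- the dimension and `s` the square root.
  refine integral_congr_ae (ae_of_all _ fun u => ?_)
  have hs : √(c + ⟪a, (u : V)⟫_ℝ ^ 2) ^ 2 = c + ⟪a, (u : V)⟫_ℝ ^ 2 :=
    Real.sq_sqrt (by positivity)
  beta_reduce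
  rw [eval_conjPowSum hs, hsgn, inner_neg_left, neg_sq, mul_left_comm, ← mul_pow, mul_add]
  ring

theorem tendsto_setIntegral_signProd (hn : IsUnitNormal ℋ n) (hℋ : IsCoxeterArrangement ℋ)
    (hcard : finrank ℝ V < #ℋ) (a : V) :
    Tendsto (fun R : ℝ => ∫ x in Metric.closedBall a R, signProd ℋ n x) atTop (𝓝 0) := by
  set m := finrank ℝ V with hm
  obtain ⟨p, hp, hlo⟩ := exists_polynomial_isLittleO m
  set μ := (volume : Measure V).toSphere
  have hρ : Tendsto (fun R : ℝ => √(R ^ 2 - ‖a‖ ^ 2)) atTop atTop :=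
    Real.tendsto_sqrt_atTop.comp (tendsto_atTop_add_const_right _ _ (tendsto_pow_atTop two_ne_zero))
  -- The sphere integral differs from a vanishing polynomial moment by the Taylor remainder.
  have hrem : ∀ R : ℝ, ‖a‖ < R → ∫ x in Metric.closedBall a R, signProd ℋ n x =
      (m : ℝ)⁻¹ * ∫ u : Metric.sphere (0 : V) 1, signProd ℋ n (u : V) *
        (√(R ^ 2 - ‖a‖ ^ 2) ^ m * ((⟪a, (u : V)⟫_ℝ / √(R ^ 2 - ‖a‖ ^ 2) +
          √(1 + (⟪a, (u : V)⟫_ℝ / √(R ^ 2 - ‖a‖ ^ 2)) ^ 2)) ^ m -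
            p.eval (⟪a, (u : V)⟫_ℝ / √(R ^ 2 - ‖a‖ ^ 2)))) ∂μ := by
    intro R hR
    have hc : 0 < R ^ 2 - ‖a‖ ^ 2 := by nlinarith [norm_nonneg a]
    set ρ := √(R ^ 2 - ‖a‖ ^ 2) with hρdef
    have hρ0 : 0 < ρ := Real.sqrt_pos.2 hc
    have hρ2 : R ^ 2 - ‖a‖ ^ 2 = ρ ^ 2 := (Real.sq_sqrt hc.le).symm
    have hmom : ∫ u : Metric.sphere (0 : V) 1, signProd ℋ n (u : V) *
        (ρ ^ m * p.eval (⟪a, (u : V)⟫_ℝ / ρ)) ∂μ = 0 := by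
      have h1 := integral_signProd_mul_polynomial hn hℋ hcard.le (d := m)
        (p := Polynomial.C (ρ ^ m) * p.comp (Polynomial.C ρ⁻¹ * Polynomial.X)) ?_ a
      · rw [sphereMoment_eq_zero hn hℋ hcard, mul_zero] at h1
        simpa [div_eq_inv_mul] using h1
      · refine (Polynomial.natDegree_C_mul_le _ _).trans (Polynomial.natDegree_comp_le.trans ?_)
        refine (Nat.mul_le_mul hp ((Polynomial.natDegree_C_mul_le _ _).trans
          Polynomial.natDegree_X_le)).trans_eq (mul_one m)
    rw [setIntegral_closedBall_signProd ℋ n hR.le, ← hm, ← sub_zero (integral μ _), ← hmom,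
      ← integral_sub]
    · congr 1
      refine integral_congr_ae (ae_of_all _ fun u => ?_)
      beta_reduce
      have h2 : ⟪a, (u : V)⟫_ℝ + √(R ^ 2 - ‖a‖ ^ 2 + ⟪a, (u : V)⟫_ℝ ^ 2) =
          ρ * (⟪a, (u : V)⟫_ℝ / ρ + √(1 + (⟪a, (u : V)⟫_ℝ / ρ) ^ 2)) := by
        have h3 : R ^ 2 - ‖a‖ ^ 2 + ⟪a, (u : V)⟫_ℝ ^ 2 =
            ρ ^ 2 * (1 + (⟪a, (u : V)⟫_ℝ / ρ) ^ 2) := by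
          rw [hρ2]; field_simp
        rw [h3, Real.sqrt_mul (sq_nonneg ρ), Real.sqrt_sq hρ0.le, mul_add,
          mul_div_cancel₀ _ hρ0.ne']
      rw [h2, mul_pow]
      ring
    · exact integrable_toSphere_signProd_mul (f := fun x =>
        (⟪a, x⟫_ℝ + √(R ^ 2 - ‖a‖ ^ 2 + ⟪a, x⟫_ℝ ^ 2)) ^ m) (by fun_prop)
    · exact integrable_toSphere_signProd_mul (f := fun x => ρ ^ m * p.eval (⟪a, x⟫_ℝ / ρ))
        (continuous_const.mul (p.continuous.comp (by fun_prop)))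
  rw [Metric.tendsto_nhds]
  intro ε hε
  -- `δ` is the Taylor error tolerance. The `+ 1` in the witness keeps its denominator positive even
  -- when `a = 0`.
  obtain ⟨δ, hδ, hδε⟩ : ∃ δ > 0, (m : ℝ)⁻¹ * (δ * ‖a‖ ^ m * μ.real Set.univ) < ε := by
    refine ⟨ε / ((m : ℝ)⁻¹ * (‖a‖ ^ m * μ.real Set.univ) + 1), by positivity, ?_⟩
    set B := (m : ℝ)⁻¹ * (‖a‖ ^ m * μ.real Set.univ) with hB
    have hB0 : 0 ≤ B := by positivity
    calc _ = ε * (B / (B + 1)) := by rw [hB]; ring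
      _ < ε * 1 := by
        gcongr
        rw [div_lt_one (by positivity)]
        linarith
      _ = ε := mul_one ε
  obtain ⟨η, hη, hηδ⟩ := Metric.eventually_nhds_iff.1 (hlo.def hδ)
  -- Since `|⟪a, u⟫| ≤ ‖a‖`, the bound `ρ > ‖a‖ / η` puts `⟪a, u⟫ / ρ` in the Taylor neighbourhood
  -- uniformly in `u`.
  filter_upwards [eventually_gt_atTop ‖a‖, hρ.eventually_gt_atTop (‖a‖ / η)] with R hR hRη
  have hc : 0 < R ^ 2 - ‖a‖ ^ 2 := by nlinarith [norm_nonneg a]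
  rw [hrem R hR, dist_zero_right, norm_mul, Real.norm_of_nonneg (by positivity)]
  set ρ := √(R ^ 2 - ‖a‖ ^ 2)
  have hρ0 : 0 < ρ := Real.sqrt_pos.2 hc
  refine lt_of_le_of_lt ?_ hδε
  gcongr
  refine norm_integral_le_of_norm_le_const (ae_of_all _ fun u => ?_)
  have hu : ‖(u : V)‖ = 1 := by simp
  have ht : |⟪a, (u : V)⟫_ℝ| ≤ ‖a‖ := by
    simpa [hu] using abs_real_inner_le_norm a (u : V)
  have h1 := hηδ (y := ⟪a, (u : V)⟫_ℝ / ρ) (by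
    rw [Real.dist_0_eq_abs, abs_div, abs_of_pos hρ0, div_lt_iff₀ hρ0, mul_comm]
    rw [div_lt_iff₀ hη] at hRη
    exact ht.trans_lt hRη)
  rw [norm_mul, norm_mul]
  calc _ ≤ 1 * (‖ρ ^ m‖ * (δ * ‖(⟪a, (u : V)⟫_ℝ / ρ) ^ m‖)) := by
        gcongr
        exact abs_signProd_le_one ℋ n u
    _ = δ * |⟪a, (u : V)⟫_ℝ| ^ m := by
        rw [norm_pow, norm_pow, Real.norm_eq_abs, Real.norm_eq_abs, abs_div, abs_of_pos hρ0, div_pow]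
        field_simp
    _ ≤ δ * ‖a‖ ^ m := by gcongr

end Pizza

end

/-! ### The pizza theorem -/

theorem theorem1p1 {V : Type*} [NormedAddCommGroup V] [InnerProductSpace ℝ V]
    [FiniteDimensional ℝ V] [MeasurableSpace V] [BorelSpace V]
    (ℋ : Finset (Submodule ℝ V)) (hℋ : Pizza.IsCoxeterArrangement ℋ)
    (T₀ : Set V) (hT₀ : T₀ ∈ Pizza.chambers ℋ)
    (hcard : finrank ℝ V ≤ #ℋ) :
    (finrank ℝ V < #ℋ → #ℋ ≡ finrank ℝ V [MOD 2] →
      ∀ (a : V) (R : ℝ), ‖a‖ ≤ R →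
        Pizza.pizzaQuantity ℋ T₀ (Metric.closedBall a R) = 0) ∧
    (finrank ℝ V < #ℋ → ¬ #ℋ ≡ finrank ℝ V [MOD 2] →
      ∀ a : V, Tendsto (fun R : ℝ => Pizza.pizzaQuantity ℋ T₀ (Metric.closedBall a R))
        atTop (𝓝 0)) ∧
    (#ℋ = finrank ℝ V →
      ∀ (a : V) (R R' : ℝ), ‖a‖ ≤ R → ‖a‖ ≤ R' →
        Pizza.pizzaQuantity ℋ T₀ (Metric.closedBall a R) =
          Pizza.pizzaQuantity ℋ T₀ (Metric.closedBall a R')) := by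
  obtain ⟨n, hn⟩ := Pizza.exists_isUnitNormal hℋ.isArrangement
  obtain ⟨c, hc⟩ := Pizza.exists_pizzaQuantity_eq_mul_integral hℋ.isArrangement hn hT₀
  rcases subsingleton_or_nontrivial V with hV | hV
  -- Polar coordinates need positive dimension. In dimension zero `ℋ` is empty, and every ball in
  -- question is the whole space.
  · have h0 : finrank ℝ V = 0 := finrank_zero_of_subsingleton
    have hempty : #ℋ = 0 := by
      refine Finset.card_eq_zero.2 (Finset.eq_empty_of_forall_notMem fun H hH => ?_)
      have := hℋ.isArrangement H hH
      omega
    refine ⟨fun h => by omega, fun h => by omega, fun _ a R R' hR hR' => ?_⟩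
    have huniv : ∀ r : ℝ, ‖a‖ ≤ r → Metric.closedBall a r = Set.univ := fun r hr =>
      Set.eq_univ_of_forall fun x => by
        rw [Metric.mem_closedBall, Subsingleton.elim x a, dist_self]
        exact (norm_nonneg a).trans hr
    rw [huniv R hR, huniv R' hR']
  · refine ⟨fun hlt hpar a R hR => ?_, fun hlt _ a => ?_, fun heq a R R' hR hR' => ?_⟩
    · have h := Pizza.two_mul_setIntegral_signProd hn hℋ hcard hpar hR
      rw [Pizza.sphereMoment_eq_zero hn hℋ hlt, mul_zero, mul_zero] at h
      rw [hc, (mul_eq_zero.1 h).resolve_left two_ne_zero, mul_zero]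
    · simp only [hc]
      simpa using (Pizza.tendsto_setIntegral_signProd hn hℋ hlt a).const_mul c
    · have hpar : #ℋ ≡ finrank ℝ V [MOD 2] := by rw [heq]
      have h := Pizza.two_mul_setIntegral_signProd hn hℋ hcard hpar hR
      rw [← Pizza.two_mul_setIntegral_signProd hn hℋ hcard hpar hR'] at h
      rw [hc, hc, mul_left_cancel₀ two_ne_zero h]
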